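/- Let $K$ be a field of characteristic different from $2$ and $3$, and let $W=\langle e,f\rangle$ be the $\mathbb Z_2$-graded $K$-vector space with $e$ even and $f$ odd. Let $C=\operatorname{Hom}(T(W),W)$, $C^n=\operatorname{Hom}(W^{\otimes n},W)$ for $n\ge 0$, with basis $\varphi^I_i$ ($I$ a word of length $n$ in $e,f$, $i\in\{e,f\}$), $\varphi^I_i(w_J)=\delta^I_J w_i$. A homogeneous cochain $\psi\in C^k$ extends to a coderivation of $T(W)$ by $$\psi(w_K)=\sum_{K=K_1K_2K_3,\ |K_2|=k}(-1)^{|w_{K_1}||\psi|}\,w_{K_1}\,\psi(w_{K_2})\,w_{K_3},$$ and $[\varphi,\psi]=\varphi\circ\psi-(-1)^{|\varphi||\psi|}\psi\circ\varphi$. Let $d_6=\psi^{ee}_f$ be the (odd) cochain $\varphi^{ee}_f$, let $D(\varphi)=[d_6,\varphi]$, and let $H^n=H^n(d_6)=\ker(D:C^n\to C^{n+1})/D(C^{n-1})$ (with $C^{-1}=0$). Let $E^n=\langle\varphi^I_e\rangle$ and $F^n=\langle\varphi^I_f\rangle$, with $I$ of length $n$, so that $C^n=E^n\oplus F^n$,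 and let $D_e:E^n\to E^{n+1}$ be the $E$-component of $D|_{E^n}$. Define $\lambda^I\varphi^J_j=\varphi^{IJ}_j$, $\theta=\lambda^{ef}-\lambda^{fe}$, and the DeCleene cochains $\operatorname{Ch}^{2m}_i=\theta^m\varphi_i$, $\operatorname{Ch}^{2m+1}_i=\theta^m\varphi^e_i$ for $i\in\{e,f\}$, $m\ge 0$, where $\varphi_i\in C^0$ is the cochain $1\mapsto w_i$. Say that $\eta\in F^n$ extends $\operatorname{Ch}^n_e$ if $D(\operatorname{Ch}^n_e+\eta)=0$. Then $(C,D)$ and $(E,D_e)$ are complexes, and for every $n\ge 0$: 1. $\dim H^n=1$ if $n\equiv 0,1\pmod 4$, and $\dim H^n=2$ if $n\equiv 2,3\pmod 4$. 2. $\operatorname{Ch}^n_e$ is a $D_e$-cocycle, and $H^n(E,D_e)$ is one-dimensional, spanned by its class. 3. $\operatorname{Ch}^n_e$ extends to a $D$-cocycle $\operatorname{Ch}^n_e+\eta$, $\eta\in F^n$, if and only if $n\not\equiv 0\pmod 4$. 4. $\operatorname{Ch}^n_f$ is a $D$-cocycle, and its class in $H^n$ is nonzero if and only if $n\not\equiv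 1\pmod 4$. 5. If $n\equiv 0\pmod 4$, then $H^n$ is spanned by the class of $\operatorname{Ch}^n_f$; and whenever $\eta\in F^n$ extends $\operatorname{Ch}^n_e$, $H^n$ is spanned by the classes of $\operatorname{Ch}^n_e+\eta$ and $\operatorname{Ch}^n_f$. -/

import Mathlib

namespace OneOne

/-- The homogeneous basis of the `1|1`-dimensional space `W = ⟨e, f⟩`. -/
inductive Letter where
  | e : Letter
  | f : Letter
  deriving DecidableEq

instance : Fintype Letter where
  elems := {Letter.e, Letter.f}
  complete i := by cases i <;> simp

/-- Multi-indices `I = (i₁, …, iₙ)` with entries in `{e, f}`. -/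
abbrev Word := List Letter

/-- `e` is even, `f` is odd. -/
def Letter.parity : Letter → ZMod 2
  | Letter.e => 0
  | Letter.f => 1

/-- The parity of the tensor `w_I = w_{i₁} ⋯ w_{iₙ}`. -/
def wordParity (I : Word) : ZMod 2 := (I.map Letter.parity).sum

section

variable {K M : Type*} [Field K] [AddCommGroup M] [Module K M]

/-- `δ` restricts to a cochain complex `X⁰ → X¹ → X² → ⋯`. -/
def IsComplex (δ : M →ₗ[K] M) (X : ℕ → Submodule K M) : Prop :=
  ∀ n : ℕ, ∀ φ ∈ X n, δ φ ∈ X (n + 1) ∧ δ (δ φ) = 0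

/-- The `n`-cocycles of `(X, δ)`. -/
def cocycles (δ : M →ₗ[K] M) (X : ℕ → Submodule K M) (n : ℕ) : Submodule K M :=
  X n ⊓ LinearMap.ker δ

/-- The `n`-coboundaries of `(X, δ)`. -/
def coboundaries (δ : M →ₗ[K] M) (X : ℕ → Submodule K M) : ℕ → Submodule K M
  | 0 => ⊥
  | n + 1 => (X n).map δ

/-- The `n`-th cohomology space of `(X, δ)`. -/
abbrev cohomology (δ : M →ₗ[K] M) (X : ℕ → Submodule K M) (n : ℕ) : Type _ :=
  cocycles δ X n ⧸ (coboundaries δ X n).submoduleOf (cocycles δ X n)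

/-- The cohomology class of a cocycle. -/
abbrev cohomologyClass {δ : M →ₗ[K] M} {X : ℕ → Submodule K M} {n : ℕ} {φ : M}
    (h : φ ∈ cocycles δ X n) : cohomology δ X n :=
  Submodule.Quotient.mk ⟨φ, h⟩

end

section

variable (K : Type*) [Field K]

/-- The sign `(-1)^p`. -/
def sgn (p : ZMod 2) : K := if p = 0 then 1 else -1

/-- The vector space `W` with basis `e, f`, as coordinate vectors. -/
abbrev W := Letter → K

/-- The underlying space of the tensor coalgebra `T(W) = ⨁ₙ Wⁿ`: it has the tensors
`w_I`, `I` a multi-index, as a basis. -/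
abbrev T := Word →₀ K

/-- `C(W) = Hom(T(W), W)`. -/
abbrev C := T K →ₗ[K] W K

variable {K}

/-- The basis tensor `w_I` of `T(W)`. -/
noncomputable def tensor (I : Word) : T K := Finsupp.single I 1

/-- The basis cochain `φ^I_i`, with `φ^I_i (w_J) = δ^I_J w_i`. -/
noncomputable def basisCochain (I : Word) (i : Letter) : C K :=
  Finsupp.linearCombination K fun J => if J = I then Pi.single i 1 else 0

/-- The tensor `w_u ⊗ x ⊗ w_v` for `x ∈ W`. -/
noncomputable def sandwich (u v : Word) (x : W K) : T K :=
  ∑ j : Letter, x j • tensor (u ++ j :: v)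

/-- The component of parity `p` of a cochain: it sends `w_I` to the part of `φ (w_I)` of
parity `|I| + p`. Every cochain is the sum of its components of parity `0` and `1`. -/
noncomputable def part (p : ZMod 2) : C K →ₗ[K] C K where
  toFun φ := Finsupp.linearCombination K fun I => fun i =>
    if i.parity = wordParity I + p then φ (tensor I) i else 0
  map_add' φ ψ := by
    ext I i
    simp only [LinearMap.coe_comp, Function.comp_apply, Finsupp.lsingle_apply,
      Finsupp.linearCombination_single, one_smul, LinearMap.add_apply, Pi.add_apply]
    split_ifs <;> simp
  map_smul' c φ := by
    ext I i
    simp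

/-- The extension of a cochain `φ` to a coderivation of `T(W)`. For `φ` homogeneous it is
`w_K ↦ ∑ (-1)^{|K₁| |φ|} w_{K₁} φ(w_{K₂}) w_{K₃}`, the sum running over all ways of writing
`K = K₁K₂K₃` (here `K₁` has length `a` and `K₂` has length `b`); in general it is the sum of
the extensions of the two homogeneous components. -/
noncomputable def coder : C K →ₗ[K] (T K →ₗ[K] T K) where
  toFun φ := Finsupp.linearCombination K fun I =>
    ∑ p : ZMod 2, ∑ a ∈ Finset.range (I.length + 1), ∑ b ∈ Finset.range (I.length - a + 1),
      sgn K (wordParity (I.take a) * p) •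
        sandwich (I.take a) (I.drop (a + b)) (part p φ (tensor ((I.drop a).take b)))
  map_add' φ ψ := by
    ext1 I
    ext1
    simp [sandwich, add_smul, Finset.sum_add_distrib, smul_add]
  map_smul' c φ := by
    ext1 I
    ext1
    simp only [LinearMap.coe_comp, Function.comp_apply, Finsupp.lsingle_apply,
      Finsupp.linearCombination_single, one_smul, LinearMap.smul_apply, RingHom.id_apply,
      map_smul, sandwich, Pi.smul_apply, Finset.smul_sum, smul_eq_mul, mul_smul]
    simp only [smul_comm c]

/-- The composition `φ ∘ ψ` of cochains: `ψ` is extended to a coderivation first. -/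
noncomputable def circ : C K →ₗ[K] C K →ₗ[K] C K where
  toFun φ := (LinearMap.compRight K φ).comp coder
  map_add' φ ψ := by ext; simp
  map_smul' c φ := by ext; simp

/-- The bracket of coderivations, `[φ, ψ] = φ ∘ ψ - (-1)^{|φ||ψ|} ψ ∘ φ` for homogeneous
`φ`, `ψ`, extended bilinearly. -/
noncomputable def bracket (φ : C K) : C K →ₗ[K] C K :=
  ∑ p : ZMod 2, ∑ q : ZMod 2,
    ((circ (part p φ)).comp (part q) - sgn K (p * q) • (circ.flip (part p φ)).comp (part q))

variable (K)

/-- `Cⁿ = Hom(Wⁿ, W)`: the cochains that vanish on the tensors of degree other than `n`. -/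
noncomputable def cochains (n : ℕ) : Submodule K (C K) where
  carrier := {φ | ∀ I : Word, I.length ≠ n → φ (tensor I) = 0}
  add_mem' {φ ψ} hφ hψ := fun I hI => by simp [hφ I hI, hψ I hI]
  zero_mem' := fun I _ => by simp
  smul_mem' c φ hφ := fun I hI => by simp [hφ I hI]

/-- The span of the `φ^I_i` with `ℓ(I) = n`: the elements of `Cⁿ` with values in the line
spanned by `w_i`. -/
noncomputable def cochainsInto (i : Letter) (n : ℕ) : Submodule K (C K) where
  carrier := {φ | φ ∈ cochains K n ∧ ∀ I : Word, ∀ j : Letter, j ≠ i → φ (tensor I) j = 0}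
  add_mem' {φ ψ} hφ hψ :=
    ⟨add_mem hφ.1 hψ.1, fun I j hj => by simp [hφ.2 I j hj, hψ.2 I j hj]⟩
  zero_mem' := ⟨zero_mem _, fun I j _ => by simp⟩
  smul_mem' c φ hφ := ⟨Submodule.smul_mem _ c hφ.1, fun I j hj => by simp [hφ.2 I j hj]⟩

/-- `Eⁿ = ⟨φ^I_e⟩`. -/
noncomputable abbrev E : ℕ → Submodule K (C K) := cochainsInto K Letter.e

/-- `Fⁿ = ⟨φ^I_f⟩`. -/
noncomputable abbrev F : ℕ → Submodule K (C K) := cochainsInto K Letter.f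

/-- The projection of `C(W)` onto its `e`-component, which kills all `φ^I_f`. -/
noncomputable def projE : C K →ₗ[K] C K :=
  LinearMap.compRight K (LinearMap.single K (fun _ : Letter => K) Letter.e ∘ₗ
    LinearMap.proj Letter.e)

/-- The codifferential `d₆ = ψ^{ee}_f`. -/
noncomputable def d6 : C K := basisCochain [Letter.e, Letter.e] Letter.f

/-- The coboundary operator `D(φ) = [d₆, φ]`. -/
noncomputable def D : C K →ₗ[K] C K := bracket (d6 K)

/-- The operator `D_e`: the component of `D : Eⁿ → Eⁿ⁺¹ ⊕ Fⁿ⁺¹` in `Eⁿ⁺¹`. -/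
noncomputable def De : C K →ₗ[K] C K := projE K ∘ₗ D K

variable {K}

/-- The operator `λ^I`, with `λ^I φ^J_j = φ^{IJ}_j`. -/
noncomputable def lam (I : Word) : C K →ₗ[K] C K where
  toFun φ := Finsupp.linearCombination K fun L =>
    if I <+: L then φ (tensor (L.drop I.length)) else 0
  map_add' φ ψ := by
    ext L i
    simp only [LinearMap.coe_comp, Function.comp_apply, Finsupp.lsingle_apply,
      Finsupp.linearCombination_single, one_smul, LinearMap.add_apply, Pi.add_apply]
    split_ifs <;> simp
  map_smul' c φ := by
    ext L i
    simp only [LinearMap.coe_comp, Function.comp_apply, Finsupp.lsingle_apply,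
      Finsupp.linearCombination_single, one_smul, LinearMap.smul_apply, RingHom.id_apply,
      Pi.smul_apply]
    split_ifs <;> simp

variable (K)

/-- The DeCleene map `θ = λ^{ef} - λ^{fe}`. -/
noncomputable def theta : C K →ₗ[K] C K :=
  lam [Letter.e, Letter.f] - lam [Letter.f, Letter.e]

/-- The DeCleene cochains: `Ch^{2m}_i = θ^m φ_i` and `Ch^{2m+1}_i = θ^m φ^e_i`. -/
noncomputable def Ch (i : Letter) (n : ℕ) : C K :=
  (theta K ^ (n / 2)) (basisCochain (if n % 2 = 0 then [] else [Letter.e]) i)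

/-- `η ∈ Fⁿ` extends `Ch^n_e` to the `D`-cocycle `Ch^n_e + η`. -/
def IsExtension (n : ℕ) (η : C K) : Prop :=
  η ∈ F K n ∧ Ch K Letter.e n + η ∈ cocycles (D K) (cochains K) n

end

end OneOne

/-!
A cochain is a pair `(x, y)` of combinations of words in `e, f`, its components along `e` and `f`.
In these coordinates `D (x, y) = (d x, e x + x e - d y)`, where, up to signs, `d` is the derivation
of the algebra of words with `d e = 0`, `d f = e²` (`comp_D`). So `C` is the mapping cone of
`x ↦ e x + x e` on the complex of words, and two facts about words give everything.

First, the complex of words has one-dimensional cohomology in each length. The words with prefix `f`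
cancel against those with prefix `ee`; what is left is `1`, `e` and the words with prefix `ef`, and
the latter form a copy of the whole complex, shifted by two, which `θ = ef - fe` lifts to cocycles.
By induction the cohomology is spanned by `θ^m` in length `2m` and `θ^m e` in length `2m + 1`
(`exists_eq_smul_chain_add`, `eq_zero_of_smul_chain_eq_diff`).

Second, `e θ + θ e = [e², f]` is a coboundary up to sign, with primitive `f²`, so that left
multiplication by `e` anticommutes with `θ` on cohomology. Hence `e θ^m + θ^m e` is cohomologous to
`(1 + (-1)^m) θ^m e`, while `e θ^m e + θ^m e e` is a coboundary because `e² = d f`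
(`anticomm_chain_sub_mem`, `anticomm_chain_mem`). As `2 ≠ 0`, the connecting map `Hⁿ(E) → Hⁿ⁺¹(F)`
is an isomorphism for `n ≡ 0` modulo 4 and zero otherwise, and the long exact sequence of
`0 → F → C → E → 0` gives the dimensions and the generators.
-/

namespace OneOne

/-! ### Formal combinations of words and their differential -/

section Words

variable {K : Type*} [Field K]

theorem sgn_add (p q : ZMod 2) : sgn K (p + q) = sgn K p * sgn K q := by
  have h : ∀ r : ZMod 2, r = 0 ∨ r = 1 := by decide
  have h2 : (1 : ZMod 2) + 1 = 0 := rfl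
  rcases h p with rfl | rfl <;> rcases h q with rfl | rfl <;> simp [sgn, h2]

theorem sgn_mul_self (p : ZMod 2) : sgn K p * sgn K p = 1 := by
  unfold sgn; split_ifs <;> simp

@[simp] theorem sgn_zero : sgn K 0 = 1 := by simp [sgn]

@[simp] theorem sgn_one : sgn K 1 = -1 := by simp [sgn]

@[simp] theorem wordParity_nil : wordParity [] = 0 := rfl

@[simp] theorem wordParity_cons (a : Letter) (I : Word) :
    wordParity (a :: I) = a.parity + wordParity I := by simp [wordParity]

@[simp] theorem parity_e : Letter.e.parity = 0 := rfl

@[simp] theorem parity_f : Letter.f.parity = 1 := rfl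

/-- The left derivative by a letter: `(shift a x) I = x (aI)`. -/
def shift (a : Letter) : (Word → K) →ₗ[K] (Word → K) :=
  LinearMap.funLeft K K (List.cons a)

theorem shift_apply (a : Letter) (x : Word → K) (I : Word) : shift a x I = x (a :: I) :=
  rfl

/-- A combination of words is determined by its constant term and its left derivatives. -/
theorem ext_shift {x y : Word → K} (h0 : x [] = y []) (he : shift .e x = shift .e y)
    (hf : shift .f x = shift .f y) : x = y := by
  funext I
  match I with
  | [] => exact h0
  | .e :: I => exact congrFun he I
  | .f :: I => exact congrFun hf I

/-- Coinduction for identities between operators on combinations of words: it is enough that the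
constant terms agree and that each left derivative of the difference is again a difference. -/
theorem eq_of_shift {X : Type*} (F G : X → Word → K) (h0 : ∀ x, F x [] = G x [])
    (hs : ∀ a x, ∃ y, shift a (F x) - shift a (G x) = F y - G y) (x : X) : F x = G x := by
  funext I
  induction I generalizing x with
  | nil => exact h0 x
  | cons a I ih =>
    obtain ⟨y, hy⟩ := hs a x
    have h := congrFun hy I
    simp only [Pi.sub_apply, ih y, sub_self, shift_apply] at h
    exact sub_eq_zero.mp h

/-- The empty word, as a combination of words. -/
def unit : Word → K := Pi.single [] 1

@[simp] theorem unit_nil : (unit : Word → K) [] = 1 := by simp [unit]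

@[simp] theorem unit_cons (a : Letter) (I : Word) : (unit : Word → K) (a :: I) = 0 := by
  simp [unit]

@[simp] theorem shift_unit (a : Letter) : shift a (unit : Word → K) = 0 := by
  funext I; simp [shift_apply]

/-- Left multiplication of a combination of words by a letter. -/
def mulLeft (a : Letter) : (Word → K) →ₗ[K] (Word → K) where
  toFun x
    | [] => 0
    | b :: I => if b = a then x I else 0
  map_add' x y := by
    funext I; cases I <;> simp [ite_add_zero]
  map_smul' c x := by
    funext I; cases I <;> simp

@[simp] theorem mulLeft_nil (a : Letter) (x : Word → K) : mulLeft a x [] = 0 := rfl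

@[simp] theorem mulLeft_cons (a b : Letter) (x : Word → K) (I : Word) :
    mulLeft a x (b :: I) = if b = a then x I else 0 := rfl

@[simp] theorem shift_mulLeft_self (a : Letter) (x : Word → K) : shift a (mulLeft a x) = x := by
  funext I; simp [shift_apply]

@[simp] theorem shift_e_mulLeft_f (x : Word → K) : shift .e (mulLeft .f x) = 0 := by
  funext I; simp [shift_apply]

@[simp] theorem shift_f_mulLeft_e (x : Word → K) : shift .f (mulLeft .e x) = 0 := by
  funext I; simp [shift_apply]

/-- The values `x ↦ (x e) I` of right multiplication by `e`, by recursion on the word `I`. -/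
def mulRightAux : Word → (Word → K) →ₗ[K] K
  | [] => 0
  | a :: I => mulRightAux I ∘ₗ shift a + if a = .e ∧ I = [] then LinearMap.proj [] else 0

/-- Right multiplication of a combination of words by `e`. -/
def mulRight : (Word → K) →ₗ[K] (Word → K) := LinearMap.pi mulRightAux

theorem mulRight_apply (x : Word → K) (I : Word) : mulRight x I = mulRightAux I x := rfl

@[simp] theorem mulRight_nil (x : Word → K) : mulRight x [] = 0 := rfl

@[simp] theorem shift_f_mulRight (x : Word → K) :
    shift .f (mulRight x) = mulRight (shift .f x) := by
  funext I; simp [shift_apply, mulRight_apply, mulRightAux]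

@[simp] theorem shift_e_mulRight (x : Word → K) :
    shift .e (mulRight x) = mulRight (shift .e x) + x [] • unit := by
  funext I
  cases I <;> simp [shift_apply, mulRight_apply, mulRightAux]

@[simp] theorem mulRight_unit : mulRight (unit : Word → K) = mulLeft .e unit :=
  ext_shift (by simp) (by simp) (by simp)

theorem mulRight_mulLeft (a : Letter) (x : Word → K) :
    mulRight (mulLeft a x) = mulLeft a (mulRight x) := by
  cases a
  · exact ext_shift (by simp) (by simp) (by simp)
  · exact ext_shift (by simp) (by simp) (by simp)

/-- The parity involution `w_I ↦ (-1)^{|I|} w_I`. -/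
def invol : (Word → K) →ₗ[K] (Word → K) where
  toFun x I := sgn K (wordParity I) * x I
  map_add' x y := by funext I; simp [mul_add]
  map_smul' c x := by funext I; simp [mul_left_comm]

theorem invol_apply (x : Word → K) (I : Word) : invol x I = sgn K (wordParity I) * x I := rfl

@[simp] theorem invol_invol (x : Word → K) : invol (invol x) = x := by
  funext I; simp [invol_apply, ← mul_assoc, sgn_mul_self]

@[simp] theorem shift_e_invol (x : Word → K) : shift .e (invol x) = invol (shift .e x) := by
  funext I; simp [shift_apply, invol_apply]

@[simp] theorem shift_f_invol (x : Word → K) : shift .f (invol x) = -invol (shift .f x) := by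
  funext I; simp [shift_apply, invol_apply, sgn_add]

@[simp] theorem invol_nil (x : Word → K) : invol x [] = x [] := by simp [invol_apply]

@[simp] theorem invol_unit : invol (unit : Word → K) = unit :=
  ext_shift (by simp) (by simp) (by simp)

@[simp] theorem invol_mulLeft_e (x : Word → K) : invol (mulLeft .e x) = mulLeft .e (invol x) :=
  ext_shift (by simp) (by simp) (by simp)

@[simp] theorem invol_mulLeft_f (x : Word → K) : invol (mulLeft .f x) = -mulLeft .f (invol x) :=
  ext_shift (by simp) (by simp) (by simp)

theorem invol_mulRight : ∀ x : Word → K, invol (mulRight x) = mulRight (invol x) := by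
  refine eq_of_shift _ _ (by simp) fun a x => ?_
  cases a
  · exact ⟨shift .e x, by simp⟩
  · exact ⟨-shift .f x, by simp⟩

/-- The values `x ↦ (d x) I`, by recursion on the word `I`; see `diff`. -/
def diffAux : Word → (Word → K) →ₗ[K] K
  | [] => 0
  | .f :: I => diffAux I ∘ₗ shift .f
  | .e :: I => diffAux I ∘ₗ shift .e + LinearMap.proj I ∘ₗ mulLeft .e ∘ₗ invol ∘ₗ shift .f

/-- The differential on combinations of words. Up to the sign `(-1)^{|I|}` of its value at `I`,
it is the odd derivation with `e ↦ 0`, `f ↦ e²`. -/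
def diff : (Word → K) →ₗ[K] (Word → K) := LinearMap.pi diffAux

@[simp] theorem diff_nil (x : Word → K) : diff x [] = 0 := rfl

@[simp] theorem shift_f_diff (x : Word → K) : shift .f (diff x) = diff (shift .f x) := rfl

@[simp] theorem shift_e_diff (x : Word → K) :
    shift .e (diff x) = diff (shift .e x) + mulLeft .e (invol (shift .f x)) := rfl

@[simp] theorem diff_mulLeft_e (x : Word → K) : diff (mulLeft .e x) = mulLeft .e (diff x) :=
  ext_shift (by simp) (by simp) (by simp)

theorem diff_mulLeft_f (x : Word → K) :
    diff (mulLeft .f x) = mulLeft .e (mulLeft .e (invol x)) + mulLeft .f (diff x) :=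
  ext_shift (by simp) (by simp) (by simp)

theorem diff_invol : ∀ x : Word → K, diff (invol x) = -invol (diff x) := by
  refine eq_of_shift _ _ (by simp) fun a x => ?_
  cases a
  · exact ⟨shift .e x, by simp; abel⟩
  · exact ⟨-shift .f x, by simp⟩

theorem diff_diff : ∀ x : Word → K, diff (diff x) = 0 := by
  refine eq_of_shift _ _ (by simp) fun a x => ⟨shift a x, ?_⟩
  cases a <;> simp [diff_invol]

@[simp] theorem diff_unit : diff (unit : Word → K) = 0 :=
  ext_shift (by simp) (by simp) (by simp)

theorem diff_mulRight : ∀ x : Word → K, diff (mulRight x) = mulRight (diff x) := by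
  refine eq_of_shift _ _ (by simp) fun a x => ⟨shift a x, ?_⟩
  cases a <;> simp [invol_mulRight, mulRight_mulLeft]

/-- The operator `x ↦ (ef - fe) x`. -/
def thetaWord : (Word → K) →ₗ[K] (Word → K) :=
  mulLeft .e ∘ₗ mulLeft .f - mulLeft .f ∘ₗ mulLeft .e

theorem thetaWord_apply (x : Word → K) :
    thetaWord x = mulLeft .e (mulLeft .f x) - mulLeft .f (mulLeft .e x) := rfl

theorem diff_thetaWord (x : Word → K) : diff (thetaWord x) = thetaWord (diff x) := by
  simp [thetaWord_apply, diff_mulLeft_f]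

theorem mulRight_thetaWord (x : Word → K) : mulRight (thetaWord x) = thetaWord (mulRight x) := by
  simp [thetaWord_apply, mulRight_mulLeft]

/-- Modulo coboundaries, left multiplication by `e` anticommutes with `θ` on cocycles, because
`eθ + θe = [e², f]` and `f²` bounds this commutator up to sign. -/
theorem mulLeft_thetaWord {z : Word → K} (hz : diff z = 0) :
    mulLeft .e (thetaWord z) =
      -thetaWord (mulLeft .e z) - diff (mulLeft .f (mulLeft .f (invol z))) := by
  simp only [thetaWord_apply, diff_mulLeft_f, invol_mulLeft_f, invol_invol, diff_invol, hz,
    map_neg, map_zero, map_add, map_sub]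
  abel

/-- The DeCleene cochains as combinations of words: `θ^m` in length `2m`, `θ^m e` in length
`2m + 1`. -/
def chain (n : ℕ) : Word → K := (thetaWord ^ (n / 2)) (if n % 2 = 0 then unit else mulLeft .e unit)

theorem chain_zero : chain 0 = (unit : Word → K) := rfl

theorem chain_one : chain 1 = (mulLeft .e unit : Word → K) := rfl

theorem chain_add_two (n : ℕ) : chain (n + 2) = (thetaWord (chain n) : Word → K) := by
  simp only [chain, Nat.add_mod_right, Nat.add_div_right n two_pos, pow_succ', Module.End.mul_apply]

theorem diff_chain (n : ℕ) : diff (chain n : Word → K) = 0 := by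
  induction n using Nat.twoStepInduction with
  | zero => simp [chain_zero]
  | one => simp [chain_one]
  | more n ih _ => rw [chain_add_two, diff_thetaWord, ih, map_zero]

/-! ### Cohomology of the differential on words -/

variable (K) in
/-- The combinations of words of length `n`. -/
def homogeneous (n : ℕ) : Submodule K (Word → K) where
  carrier := {x | ∀ I : Word, I.length ≠ n → x I = 0}
  add_mem' {x y} hx hy := fun I hI => by simp [hx I hI, hy I hI]
  zero_mem' := fun I _ => rfl
  smul_mem' c x hx := fun I hI => by simp [hx I hI]

theorem mem_homogeneous_iff_shift {x : Word → K} {n : ℕ} :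
    x ∈ homogeneous K (n + 1) ↔ x [] = 0 ∧ ∀ a, shift a x ∈ homogeneous K n := by
  constructor
  · exact fun h => ⟨h [] (by simp), fun a I hI => h (a :: I) (by simpa using hI)⟩
  · rintro ⟨h0, h⟩ (_ | ⟨a, I⟩) hI
    · exact h0
    · exact h a I (by simpa using hI)

theorem shift_mem {x : Word → K} {n : ℕ} (hx : x ∈ homogeneous K (n + 1)) (a : Letter) :
    shift a x ∈ homogeneous K n := (mem_homogeneous_iff_shift.mp hx).2 a

theorem eq_smul_unit {x : Word → K} (hx : x ∈ homogeneous K 0) : x = x [] • unit := by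
  funext I
  cases I with
  | nil => simp
  | cons a I => simp [hx (a :: I) (by simp)]

theorem unit_mem : unit ∈ homogeneous K 0 := by
  rintro (_ | ⟨a, I⟩) hI <;> simp_all

theorem mulLeft_mem {x : Word → K} {n : ℕ} (hx : x ∈ homogeneous K n) (a : Letter) :
    mulLeft a x ∈ homogeneous K (n + 1) := by
  refine mem_homogeneous_iff_shift.mpr ⟨rfl, fun b => ?_⟩
  cases a <;> cases b <;> simp [hx]

theorem invol_mem {x : Word → K} {n : ℕ} (hx : x ∈ homogeneous K n) :
    invol x ∈ homogeneous K n := fun I hI => by simp [invol_apply, hx I hI]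

theorem mulRight_mem {x : Word → K} {n : ℕ} (hx : x ∈ homogeneous K n) :
    mulRight x ∈ homogeneous K (n + 1) := by
  induction n generalizing x with
  | zero =>
    rw [eq_smul_unit hx, map_smul, mulRight_unit]
    exact Submodule.smul_mem _ _ (mulLeft_mem unit_mem _)
  | succ n ih =>
    refine mem_homogeneous_iff_shift.mpr ⟨rfl, fun b => ?_⟩
    cases b <;> simp [ih (shift_mem hx _), hx [] (by simp)]

theorem diff_mem {x : Word → K} {n : ℕ} (hx : x ∈ homogeneous K n) :
    diff x ∈ homogeneous K (n + 1) := by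
  induction n generalizing x with
  | zero =>
    rw [eq_smul_unit hx, map_smul, diff_unit, smul_zero]
    exact zero_mem _
  | succ n ih =>
    refine mem_homogeneous_iff_shift.mpr ⟨rfl, fun b => ?_⟩
    cases b
    · exact add_mem (ih (shift_mem hx _)) (mulLeft_mem (invol_mem (shift_mem hx _)) _)
    · exact ih (shift_mem hx _)

theorem thetaWord_mem {x : Word → K} {n : ℕ} (hx : x ∈ homogeneous K n) :
    thetaWord x ∈ homogeneous K (n + 2) :=
  sub_mem (mulLeft_mem (mulLeft_mem hx _) _) (mulLeft_mem (mulLeft_mem hx _) _)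

theorem chain_mem (n : ℕ) : chain n ∈ homogeneous K n := by
  induction n using Nat.twoStepInduction with
  | zero => exact unit_mem
  | one => exact mulLeft_mem unit_mem _
  | more n ih _ => rw [chain_add_two]; exact thetaWord_mem ih

variable (K) in
/-- The coboundaries of `diff` among the combinations of words of length `n`. -/
def boundaries (n : ℕ) : Submodule K (Word → K) := coboundaries diff (homogeneous K) n

theorem diff_mem_boundaries {y : Word → K} {n : ℕ} (hy : y ∈ homogeneous K n) :
    diff y ∈ boundaries K (n + 1) := ⟨y, hy, rfl⟩

theorem thetaWord_mem_boundaries {x : Word → K} {n : ℕ} (hx : x ∈ boundaries K n) :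
    thetaWord x ∈ boundaries K (n + 2) := by
  cases n with
  | zero =>
    obtain rfl : x = 0 := hx
    rw [map_zero]; exact zero_mem _
  | succ n =>
    obtain ⟨y, hy, rfl⟩ := hx
    rw [← diff_thetaWord]
    exact diff_mem_boundaries (thetaWord_mem hy)

/-- Each cocycle on words is, up to a coboundary, a multiple of the DeCleene cochain. In length at
least two, eliminating the words with prefix `f` against those with prefix `ee` exhibits a cocycle
`x` as `θ v` plus a coboundary, with `v` the cocycle of coefficients of the prefix `ef`. -/
theorem exists_eq_smul_chain_add (n : ℕ) {x : Word → K} (hx : x ∈ homogeneous K n)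
    (hd : diff x = 0) : ∃ c : K, ∃ b ∈ boundaries K n, x = c • chain n + b := by
  induction n using Nat.twoStepInduction generalizing x with
  | zero => exact ⟨x [], 0, zero_mem _, by rw [add_zero, chain_zero]; exact eq_smul_unit hx⟩
  | one =>
    refine ⟨x [.e], 0, zero_mem _, ?_⟩
    have hf : x [.f] = 0 := by
      have h := congrFun (congrArg (shift .e) (congrArg (shift .e) hd)) []
      simp only [shift_e_diff, map_add, Pi.add_apply, shift_mulLeft_self, diff_nil, mulLeft_nil,
        invol_nil, map_zero] at h
      simpa [shift_apply] using h
    have he := eq_smul_unit (shift_mem hx .e)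
    have hf' := eq_smul_unit (shift_mem hx .f)
    rw [shift_apply] at he hf'
    rw [hf, zero_smul] at hf'
    rw [chain_one, add_zero]
    exact ext_shift (by simpa using hx [] (by simp)) (by simpa using he) (by simpa using hf')
  | more n ih _ =>
    set u := shift .e (shift .e x)
    set v := shift .f (shift .e x)
    have hv : v ∈ homogeneous K n := shift_mem (shift_mem hx _) _
    have hu : u ∈ homogeneous K n := shift_mem (shift_mem hx _) _
    have hxe : shift .e x = mulLeft .e u + mulLeft .f v :=
      ext_shift (by simpa using shift_mem hx .e [] (by simp)) (by simp [u]) (by simp [v])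
    have hde := congrArg (shift .e) hd
    have hvd : diff v = 0 := by simpa [v] using congrArg (shift .f) hde
    have hxf : shift .f x = -invol (diff u) - mulLeft .e v := by
      have h := congrArg invol (congrArg (shift .e) hde)
      simp only [shift_e_diff, map_add, shift_mulLeft_self, map_zero, invol_invol,
        invol_mulLeft_e] at h
      rw [← sub_eq_zero, ← h]
      abel
    have hxv : x = thetaWord v + diff (mulLeft .f (invol u)) := by
      refine ext_shift (by simpa [thetaWord_apply] using hx [] (by simp)) ?_ ?_
      · simp [thetaWord_apply, hxe, add_comm]
      · simp [thetaWord_apply, hxf, diff_invol, sub_eq_add_neg, add_comm]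
    obtain ⟨c, b, hb, hvb⟩ := ih hv hvd
    refine ⟨c, thetaWord b + diff (mulLeft .f (invol u)),
      add_mem (thetaWord_mem_boundaries hb) (diff_mem_boundaries (mulLeft_mem (invol_mem hu) _)), ?_⟩
    rw [chain_add_two, ← add_assoc, ← map_smul, ← map_add, ← hvb, ← hxv]

/-- The DeCleene cochain is not a coboundary: taking the coefficient of the prefix `ef` turns a
primitive of `c θ z` into a primitive of `c z`. -/
theorem eq_zero_of_smul_chain_eq_diff (n : ℕ) {c : K} {y : Word → K}
    (h : c • chain n = diff y) : c = 0 := by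
  induction n using Nat.twoStepInduction generalizing y with
  | zero => simpa [chain_zero] using congrFun h []
  | one => simpa [chain_one] using congrFun (congrArg (shift .e) h) []
  | more n ih _ =>
    have h' := congrArg (shift .f) (congrArg (shift .e) h)
    exact ih (y := shift .f (shift .e y)) (by simpa [chain_add_two, thetaWord_apply] using h')

theorem eq_zero_of_smul_chain_mem_boundaries {n : ℕ} {c : K}
    (h : c • chain n ∈ boundaries K n) : c = 0 := by
  cases n with
  | zero => exact eq_zero_of_smul_chain_eq_diff 0 (y := 0) (by rw [map_zero]; exact h)
  | succ n =>
    obtain ⟨y, -, hy⟩ := h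
    exact eq_zero_of_smul_chain_eq_diff _ hy.symm

/-! ### The anticommutator with `e` -/

theorem mulRight_chain_even (m : ℕ) : mulRight (chain (2 * m) : Word → K) = chain (2 * m + 1) := by
  induction m with
  | zero => simp [chain_zero, chain_one]
  | succ m ih =>
    rw [show 2 * (m + 1) = 2 * m + 2 by ring, chain_add_two, mulRight_thetaWord, ih,
      show 2 * m + 2 + 1 = 2 * m + 1 + 2 by ring, chain_add_two]

theorem mulRight_chain_odd (m : ℕ) :
    mulRight (chain (2 * m + 1)) ∈ boundaries K (2 * m + 2) := by
  induction m with
  | zero =>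
    -- `e² = d f`
    refine ⟨mulLeft .f unit, mulLeft_mem unit_mem _, ?_⟩
    simp [chain_one, diff_mulLeft_f, mulRight_mulLeft]
  | succ m ih =>
    rw [show 2 * (m + 1) + 1 = 2 * m + 1 + 2 by ring, chain_add_two, mulRight_thetaWord]
    exact thetaWord_mem_boundaries ih

theorem mulLeft_chain_sub_mem (n : ℕ) :
    mulLeft .e (chain n) - (-1 : K) ^ (n / 2) • mulRight (chain n) ∈ boundaries K (n + 1) := by
  induction n using Nat.twoStepInduction with
  | zero => simp [chain_zero]
  | one => simp [chain_one, mulRight_mulLeft]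
  | more n ih _ =>
    have h : mulLeft .e (chain (n + 2) : Word → K) - (-1 : K) ^ ((n + 2) / 2) • mulRight (chain (n + 2)) =
        -thetaWord (mulLeft .e (chain n : Word → K) - (-1 : K) ^ (n / 2) • mulRight (chain n)) -
          diff (mulLeft .f (mulLeft .f (invol (chain n : Word → K)))) := by
      rw [chain_add_two, mulLeft_thetaWord (diff_chain n), mulRight_thetaWord,
        Nat.add_div_right n two_pos, pow_succ, map_sub, map_smul, mul_neg_one, neg_smul]
      abel
    rw [h]
    exact sub_mem (neg_mem (thetaWord_mem_boundaries ih))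
      (diff_mem_boundaries (mulLeft_mem (mulLeft_mem (invol_mem (chain_mem n)) _) _))

/-- The operator `x ↦ ex + xe`. -/
def anticomm : (Word → K) →ₗ[K] (Word → K) := mulLeft .e + mulRight

theorem anticomm_mem {x : Word → K} {n : ℕ} (hx : x ∈ homogeneous K n) :
    anticomm x ∈ homogeneous K (n + 1) := add_mem (mulLeft_mem hx _) (mulRight_mem hx)

theorem diff_anticomm (x : Word → K) : diff (anticomm x) = anticomm (diff x) := by
  simp [anticomm, diff_mulRight]

theorem anticomm_mem_boundaries {x : Word → K} {n : ℕ} (hx : x ∈ boundaries K n) :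
    anticomm x ∈ boundaries K (n + 1) := by
  cases n with
  | zero =>
    obtain rfl : x = 0 := hx
    rw [map_zero]; exact zero_mem _
  | succ n =>
    obtain ⟨y, hy, rfl⟩ := hx
    rw [← diff_anticomm]
    exact diff_mem_boundaries (anticomm_mem hy)

theorem anticomm_chain_sub_mem {n : ℕ} (hn : n % 4 = 0) :
    anticomm (chain n) - (2 : K) • chain (n + 1) ∈ boundaries K (n + 1) := by
  obtain ⟨k, rfl⟩ : ∃ k, n = 2 * (2 * k) := ⟨n / 4, by omega⟩
  have h := mulLeft_chain_sub_mem (K := K) (2 * (2 * k))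
  rw [mulRight_chain_even, Nat.mul_div_cancel_left _ two_pos, pow_mul, neg_one_sq, one_pow,
    one_smul] at h
  convert h using 1
  rw [anticomm, LinearMap.add_apply, mulRight_chain_even, two_smul]
  abel

theorem anticomm_chain_mem {n : ℕ} (hn : n % 4 ≠ 0) :
    anticomm (chain n) ∈ boundaries K (n + 1) := by
  have h := mulLeft_chain_sub_mem (K := K) n
  rcases Nat.even_or_odd' n with ⟨m, rfl | rfl⟩
  · have hm : Odd m := by rw [Nat.odd_iff]; omega
    rw [Nat.mul_div_cancel_left _ two_pos, hm.neg_one_pow, neg_one_smul, sub_neg_eq_add] at h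
    exact h
  · have hr := mulRight_chain_odd (K := K) m
    have := add_mem (add_mem h (Submodule.smul_mem _ ((-1 : K) ^ ((2 * m + 1) / 2)) hr)) hr
    rwa [sub_add_cancel] at this

end Words

/-! ### Cochains in coordinates -/

section Coordinates

variable {K : Type*} [Field K]

/-- The component of a cochain along a basis vector of `W`, as a combination of words:
`φ = ∑_{I, i} (comp i φ) I • φ^I_i`. -/
noncomputable def comp (i : Letter) : C K →ₗ[K] (Word → K) where
  toFun φ I := φ (tensor I) i
  map_add' _ _ := rfl
  map_smul' _ _ := rfl

theorem comp_apply (i : Letter) (φ : C K) (I : Word) : comp i φ I = φ (tensor I) i := rfl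

theorem ext_comp {φ ψ : C K} (he : comp .e φ = comp .e ψ) (hf : comp .f φ = comp .f ψ) :
    φ = ψ := by
  ext I i
  cases i
  · simpa [comp_apply, tensor] using congrFun he I
  · simpa [comp_apply, tensor] using congrFun hf I

/-- The cochain with a given `e`-component and a given `f`-component. -/
noncomputable def ofComp (x y : Word → K) : C K :=
  Finsupp.linearCombination K fun I i => Letter.casesOn i (x I) (y I)

theorem linearCombination_tensor {M : Type*} [AddCommGroup M] [Module K M] (g : Word → M)
    (I : Word) : Finsupp.linearCombination K g (tensor I) = g I := by simp [tensor]

@[simp] theorem comp_e_ofComp (x y : Word → K) : comp .e (ofComp x y) = x := by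
  funext I; simp [comp_apply, ofComp, linearCombination_tensor]

@[simp] theorem comp_f_ofComp (x y : Word → K) : comp .f (ofComp x y) = y := by
  funext I; simp [comp_apply, ofComp, linearCombination_tensor]

theorem mem_cochains_iff {φ : C K} {n : ℕ} :
    φ ∈ cochains K n ↔ comp .e φ ∈ homogeneous K n ∧ comp .f φ ∈ homogeneous K n := by
  constructor
  · exact fun h => ⟨fun I hI => congrFun (h I hI) _, fun I hI => congrFun (h I hI) _⟩
  · intro h I hI
    funext i
    cases i
    · exact h.1 I hI
    · exact h.2 I hI

theorem mem_E_iff {φ : C K} {n : ℕ} :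
    φ ∈ E K n ↔ comp .e φ ∈ homogeneous K n ∧ comp .f φ = 0 := by
  constructor
  · exact fun h => ⟨(mem_cochains_iff.mp h.1).1, funext fun I => h.2 I _ (by simp)⟩
  · rintro ⟨h, h0⟩
    refine ⟨mem_cochains_iff.mpr ⟨h, h0 ▸ zero_mem _⟩, fun I j hj => ?_⟩
    cases j
    · exact absurd rfl hj
    · exact congrFun h0 I

theorem mem_F_iff {φ : C K} {n : ℕ} :
    φ ∈ F K n ↔ comp .e φ = 0 ∧ comp .f φ ∈ homogeneous K n := by
  constructor
  · exact fun h => ⟨funext fun I => h.2 I _ (by simp), (mem_cochains_iff.mp h.1).2⟩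
  · rintro ⟨h0, h⟩
    refine ⟨mem_cochains_iff.mpr ⟨h0 ▸ zero_mem _, h⟩, fun I j hj => ?_⟩
    cases j
    · exact congrFun h0 I
    · exact absurd rfl hj

theorem comp_basisCochain (I : Word) (i j : Letter) :
    comp j (basisCochain I i : C K) = if j = i then Pi.single I 1 else 0 := by
  funext J
  rw [comp_apply, basisCochain, linearCombination_tensor]
  by_cases h : j = i <;> by_cases hJ : J = I <;> simp [h, hJ]

theorem comp_lam_pair (a b i : Letter) (φ : C K) :
    comp i (lam [a, b] φ) = mulLeft a (mulLeft b (comp i φ)) := by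
  funext L
  have h : lam [a, b] φ (tensor L) = if [a, b] <+: L then φ (tensor (L.drop 2)) else 0 :=
    linearCombination_tensor _ L
  rw [comp_apply, h]
  rcases L with _ | ⟨c, _ | ⟨d, L⟩⟩
  · simp
  · simp
  · by_cases hc : c = a <;> by_cases hd : d = b <;>
      simp [hc, hd, comp_apply, List.cons_prefix_cons, eq_comm (a := a), eq_comm (a := b)]

theorem comp_theta (i : Letter) (φ : C K) : comp i (theta K φ) = thetaWord (comp i φ) := by
  rw [theta, LinearMap.sub_apply, map_sub, comp_lam_pair, comp_lam_pair, thetaWord_apply]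

theorem comp_Ch (i j : Letter) (n : ℕ) :
    comp j (Ch K i n) = if j = i then chain n else 0 := by
  have h : ∀ (m : ℕ) (φ : C K), comp j ((theta K ^ m) φ) = (thetaWord ^ m) (comp j φ) := by
    intro m φ
    induction m with
    | zero => rfl
    | succ m ih => rw [pow_succ', pow_succ', Module.End.mul_apply, comp_theta, ih]; rfl
  have h1 : (Pi.single [.e] 1 : Word → K) = mulLeft .e unit := by
    refine ext_shift (by simp) ?_ ?_ <;> funext I <;> cases I <;> simp [shift_apply]
  rw [Ch, h, comp_basisCochain, chain]
  by_cases hj : j = i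
  · by_cases hn : n % 2 = 0
    · simp [hj, hn, unit]
    · simp [hj, hn, h1]
  · simp [hj]

/-! ### The coboundary operator in coordinates -/

theorem d6_tensor (I : Word) :
    d6 K (tensor I) = if I = [.e, .e] then Pi.single .f 1 else 0 :=
  linearCombination_tensor _ I

theorem part_tensor (p : ZMod 2) (φ : C K) (I : Word) (i : Letter) :
    part p φ (tensor I) i = if i.parity = wordParity I + p then φ (tensor I) i else 0 := by
  exact congrFun (linearCombination_tensor (K := K) (M := W K) _ I) i

theorem comp_part (p : ZMod 2) (φ : C K) (I : Word) (i : Letter) :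
    comp i (part p φ) I = if p = i.parity + wordParity I then comp i φ I else 0 := by
  rw [comp_apply, part_tensor]
  have : ∀ a b p : ZMod 2, a = b + p ↔ p = a + b := by decide
  simp only [this, comp_apply]

theorem sum_part (φ : C K) : ∑ p : ZMod 2, part p φ = φ := by
  have h : ∀ i, comp i (∑ p : ZMod 2, part p φ) = comp i φ := by
    intro i
    funext I
    rw [map_sum, Finset.sum_apply]
    simp only [comp_part, Finset.sum_ite_eq', Finset.mem_univ, if_true]
  exact ext_comp (h _) (h _)

theorem part_d6 (p : ZMod 2) : part p (d6 K) = if p = 1 then d6 K else 0 := by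
  have h : ∀ i I, comp i (d6 K) I = if i = .f ∧ I = [.e, .e] then 1 else 0 := by
    intro i I
    rw [d6, comp_basisCochain]
    by_cases h1 : i = .f <;> by_cases h2 : I = [.e, .e] <;> simp [h1, h2]
  have : ∀ i, comp i (part p (d6 K)) = comp i (if p = 1 then d6 K else 0) := by
    intro i
    funext I
    rw [comp_part, h]
    by_cases h' : i = .f ∧ I = [.e, .e]
    · obtain ⟨rfl, rfl⟩ := h'
      by_cases hp : p = 1 <;> simp [hp, h]
    · by_cases hp : p = 1 <;> simp [hp, h, h']
  exact ext_comp (this _) (this _)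

theorem coder_tensor (φ : C K) (I : Word) :
    coder φ (tensor I) =
      ∑ p : ZMod 2, ∑ a ∈ Finset.range (I.length + 1), ∑ b ∈ Finset.range (I.length - a + 1),
      sgn K (wordParity (I.take a) * p) •
        sandwich (I.take a) (I.drop (a + b)) (part p φ (tensor ((I.drop a).take b))) :=
  linearCombination_tensor _ I

/-- In `φ ∘ d₆`, a word contributes through its factorisations `K₁ ee K₃`, with sign
`(-1)^{|K₁|}`; the left-hand side weighs the term `K₁ f K₃` by its own parity. -/
theorem linearCombination_coder_d6 (I : Word) (x : Word → K) :
    Finsupp.linearCombination K (invol x) (coder (d6 K) (tensor I)) = -diff x I := by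
  have hc : ∀ I : Word, coder (d6 K) (tensor I) =
      ∑ a ∈ Finset.range (I.length + 1), ∑ b ∈ Finset.range (I.length - a + 1),
      sgn K (wordParity (I.take a)) •
        sandwich (I.take a) (I.drop (a + b)) (d6 K (tensor ((I.drop a).take b))) := by
    intro I
    rw [coder_tensor, Finset.sum_eq_single 1]
    · simp [part_d6]
    · intro p _ hp
      simp [part_d6, hp, sandwich]
    · simp
  have hs : ∀ (y : Word → K) (u v : Word) (w : W K),
      Finsupp.linearCombination K y (sandwich u v w) = ∑ j, w j * y (u ++ j :: v) := by
    intro y u v w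
    simp [sandwich, linearCombination_tensor]
  have hl : ∀ (I : Word) (y : Word → K),
      Finsupp.linearCombination K y (coder (d6 K) (tensor I)) =
      ∑ a ∈ Finset.range (I.length + 1), ∑ b ∈ Finset.range (I.length - a + 1),
      sgn K (wordParity (I.take a)) *
        if (I.drop a).take b = [.e, .e] then y (I.take a ++ .f :: I.drop (a + b)) else 0 := by
    intro I y
    rw [hc]
    simp only [map_sum, map_smul, hs, d6_tensor, smul_eq_mul]
    refine Finset.sum_congr rfl fun a _ => Finset.sum_congr rfl fun b _ => ?_
    split_ifs with h
    · rw [Finset.sum_eq_single .f] <;> simp +contextual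
    · simp
  induction I generalizing x with
  | nil => simp [hl]
  | cons c I ih =>
    -- the factorisations with `K₁` nonempty are those of `I`, those with `K₁` empty need the
    -- prefix `ee`
    have hrec : Finsupp.linearCombination K (invol x) (coder (d6 K) (tensor (c :: I))) =
        sgn K c.parity *
          Finsupp.linearCombination K (shift c (invol x)) (coder (d6 K) (tensor I)) +
        ∑ b ∈ Finset.range (I.length + 2),
          if (c :: I).take b = [.e, .e] then invol x (.f :: (c :: I).drop b) else 0 := by
      rw [hl, hl, List.length_cons, Finset.sum_range_succ', Finset.mul_sum]
      congr 1
      · refine Finset.sum_congr rfl fun a _ => ?_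
        rw [Finset.mul_sum, Nat.add_sub_add_right]
        refine Finset.sum_congr rfl fun b _ => ?_
        simp only [List.take_succ_cons, List.drop_succ_cons, wordParity_cons, sgn_add,
          List.cons_append, shift_apply, mul_assoc, add_right_comm a 1 b]
      · simp
    rw [hrec]
    cases c with
    | f =>
      rw [Finset.sum_eq_zero, add_zero, shift_f_invol, parity_f, sgn_one]
      · rw [show -invol (shift .f x) = invol (-shift .f x) by simp, ih]
        change _ = -(shift .f (diff x) I)
        simp
      · intro b _
        cases b <;> simp
    | e =>
      rw [shift_e_invol, ih, parity_e, sgn_zero, one_mul]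
      change _ = -(shift .e (diff x) I)
      rw [shift_e_diff, Pi.add_apply, neg_add]
      congr 1
      rcases I with _ | ⟨_ | _, I⟩
      · simp [Finset.sum_range_succ]
      · rw [Finset.sum_eq_single 2]
        · simp [invol_apply, sgn_add, shift_apply]
        · rintro (_ | _ | _ | b) hb' hb
          · simp
          · simp
          · exact absurd rfl hb
          · cases I with
            | nil =>
              simp only [List.length_cons, List.length_nil, Finset.mem_range] at hb'
              omega
            | cons => simp
        · simp
      · rw [Finset.sum_eq_zero]
        · simp
        · rintro (_ | _ | b) _ <;> simp

theorem mulRight_eq_sum (x : Word → K) (I : Word) : mulRight x I =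
    ∑ b ∈ Finset.range (I.length + 1), if I.drop b = [.e] then x (I.take b) else 0 := by
  induction I generalizing x with
  | nil => simp
  | cons c I ih =>
    have h : mulRight x (c :: I) =
        mulRight (shift c x) I + if c = .e ∧ I = [] then x [] else 0 := by
      simp only [mulRight_apply, mulRightAux]
      split_ifs <;> simp
    rw [List.length_cons, Finset.sum_range_succ', h, ih]
    congr 1
    simp

theorem anticomm_eq_sum (x : Word → K) (I : Word) : anticomm x I =
    ∑ a ∈ Finset.range (I.length + 1), ∑ b ∈ Finset.range (I.length - a + 1),
      if I.take a ++ .e :: I.drop (a + b) = [.e, .e] then x ((I.drop a).take b) else 0 := by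
  rw [anticomm, LinearMap.add_apply, Pi.add_apply]
  cases I with
  | nil => simp
  | cons c I =>
    rw [List.length_cons, Finset.sum_range_succ', mulRight_eq_sum]
    congr 1
    · rw [Finset.sum_eq_single 0]
      · rw [Finset.sum_eq_single I.length]
        · simp
        · intro b hb hb'
          have : b < I.length := by simp at hb; omega
          simp only [zero_add, List.take_succ_cons, List.take_zero, List.cons_append,
            List.nil_append, List.cons.injEq, add_comm 1 b, List.drop_succ_cons,
            List.drop_eq_nil_iff, ite_eq_right_iff]
          rintro ⟨_, h⟩
          omega
        · simp
      · intro a ha ha'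
        refine Finset.sum_eq_zero fun b _ => ?_
        have hI : I ≠ [] := by rintro rfl; simp at ha; exact ha' ha
        refine if_neg fun h => ?_
        have hl := congrArg List.length h
        have := List.length_pos_iff.mpr hI
        simp only [List.take_succ_cons, List.cons_append, List.length_cons, List.length_append,
          List.length_take, List.length_nil] at hl
        omega
      · simp
    · simp

/-- In `d₆ ∘ φ`, only the `e`-component of `φ` contributes, through the factorisations with
`K₁ K₃ = e`. -/
theorem d6_coder (φ : C K) (I : Word) :
    d6 K (coder φ (tensor I)) = Pi.single .f (anticomm (comp .e φ) I) := by
  have hs : ∀ (u v : Word) (w : W K), d6 K (sandwich u v w) =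
      Pi.single .f (if u ++ .e :: v = [.e, .e] then w .e else 0) := by
    intro u v w
    rw [sandwich, map_sum, Finset.sum_eq_single .e]
    · rw [map_smul, d6_tensor]
      split_ifs
      · rw [← Pi.single_smul, smul_eq_mul, mul_one]
      · simp
    · intro j _ hj
      have : u ++ j :: v ≠ [.e, .e] := by
        intro h
        have : j ∈ [Letter.e, .e] := h ▸ by simp
        simp [hj] at this
      rw [map_smul, d6_tensor, if_neg this, smul_zero]
    · simp
  rw [coder_tensor, anticomm_eq_sum, Finset.sum_comm]
  simp only [map_sum, map_smul, hs]
  rw [← LinearMap.single_apply (R := K), map_sum]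
  refine Finset.sum_congr rfl fun a _ => ?_
  rw [Finset.sum_comm, map_sum]
  refine Finset.sum_congr rfl fun b _ => ?_
  rw [LinearMap.single_apply]
  split_ifs with h
  · have hp : wordParity (I.take a) = 0 := by
      have : ∀ c ∈ I.take a, c.parity = 0 := by
        intro c hc
        have : c ∈ [Letter.e, .e] := h ▸ by simp [hc]
        simp_all
      exact List.sum_eq_zero fun p hp => by
        obtain ⟨c, hc, rfl⟩ := List.mem_map.mp hp
        exact this c hc
    simp only [hp, zero_mul, sgn_zero, one_smul]
    rw [← LinearMap.single_apply (R := K), comp_apply]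
    conv_rhs => rw [← sum_part φ]
    rw [LinearMap.sum_apply, Finset.sum_apply, map_sum]
    rfl
  · simp

/-- In the coordinates `φ = (x, y)`, the coboundary operator is
`D (x, y) = (d x, e x + x e - d y)`. -/
theorem comp_D (φ : C K) :
    comp .e (D K φ) = diff (comp .e φ) ∧
      comp .f (D K φ) = anticomm (comp .e φ) - diff (comp .f φ) := by
  have hD : ∀ (I : Word) (i : Letter), D K φ (tensor I) i = d6 K (coder φ (tensor I)) i -
      Finsupp.linearCombination K
        (fun J => sgn K (i.parity + wordParity J) * comp i φ J) (coder (d6 K) (tensor I)) := by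
    intro I i
    have h1 : D K φ = circ (d6 K) φ - ∑ q : ZMod 2, sgn K q • circ (part q φ) (d6 K) := by
      rw [D, bracket, LinearMap.sum_apply, Finset.sum_eq_single 1]
      · simp only [LinearMap.sum_apply, LinearMap.sub_apply, LinearMap.comp_apply,
          LinearMap.smul_apply, LinearMap.flip_apply, part_d6, if_true, one_mul,
          Finset.sum_sub_distrib]
        rw [← map_sum, sum_part]
      · intro p _ hp
        simp [part_d6, hp]
      · simp
    have h2 : ∀ t : T K, (∑ q : ZMod 2, sgn K q • part q φ) t i = Finsupp.linearCombination K
        (fun J => sgn K (i.parity + wordParity J) * comp i φ J) t := by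
      intro t
      have : LinearMap.proj i ∘ₗ (∑ q : ZMod 2, sgn K q • part q φ) = Finsupp.linearCombination K
          (fun J => sgn K (i.parity + wordParity J) * comp i φ J) := by
        ext J
        change comp i (∑ q : ZMod 2, sgn K q • part q φ) J = Finsupp.linearCombination K
          (fun J => sgn K (i.parity + wordParity J) * comp i φ J) (tensor J)
        rw [linearCombination_tensor, map_sum, Finset.sum_apply]
        simp only [map_smul, Pi.smul_apply, comp_part, smul_eq_mul, mul_ite, mul_zero,
          Finset.sum_ite_eq', Finset.mem_univ, if_true]
      exact LinearMap.congr_fun this t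
    rw [h1, ← h2]
    simp [circ]
  constructor
  · funext I
    have h := linearCombination_coder_d6 I (comp .e φ)
    have he : invol (comp .e φ) =
        fun J => sgn K (Letter.e.parity + wordParity J) * comp .e φ J := by
      funext J; simp [invol_apply]
    rw [comp_apply, hD, d6_coder, ← he, h]
    simp
  · funext I
    have h := linearCombination_coder_d6 I (-comp .f φ)
    have hf : invol (-comp .f φ) =
        fun J => sgn K (Letter.f.parity + wordParity J) * comp .f φ J := by
      funext J; simp [invol_apply, sgn_add]
    rw [comp_apply, hD, d6_coder, ← hf, h]
    simp

end Coordinates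

/-! ### Cohomology classes -/

section Classes

variable {K M : Type*} [Field K] [AddCommGroup M] [Module K M] {δ : M →ₗ[K] M}
  {X : ℕ → Submodule K M} {n : ℕ}

theorem cohomologyClass_eq_zero_iff {φ : M} (h : φ ∈ cocycles δ X n) :
    cohomologyClass h = 0 ↔ φ ∈ coboundaries δ X n := by
  rw [cohomologyClass, Submodule.Quotient.mk_eq_zero]
  rfl

theorem smul_add_smul_cohomologyClass {φ ψ : M} (hφ : φ ∈ cocycles δ X n)
    (hψ : ψ ∈ cocycles δ X n) (a b : K) :
    a • cohomologyClass hφ + b • cohomologyClass hψ =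
      cohomologyClass (add_mem (Submodule.smul_mem _ a hφ) (Submodule.smul_mem _ b hψ)) := rfl

theorem span_pair_cohomologyClass_eq_top {φ ψ : M} (hφ : φ ∈ cocycles δ X n)
    (hψ : ψ ∈ cocycles δ X n)
    (h : ∀ χ ∈ cocycles δ X n, ∃ a b : K, χ - (a • φ + b • ψ) ∈ coboundaries δ X n) :
    Submodule.span K {cohomologyClass hφ, cohomologyClass hψ} = ⊤ := by
  refine eq_top_iff.mpr fun q _ => ?_
  obtain ⟨⟨χ, hχ⟩, rfl⟩ := Submodule.Quotient.mk_surjective _ q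
  obtain ⟨a, b, hab⟩ := h χ hχ
  refine Submodule.mem_span_pair.mpr ⟨a, b, ?_⟩
  rw [smul_add_smul_cohomologyClass]
  refine ((Submodule.Quotient.eq _).mpr ?_).symm
  exact hab

theorem span_cohomologyClass_eq_top {φ : M} (hφ : φ ∈ cocycles δ X n)
    (h : ∀ χ ∈ cocycles δ X n, ∃ a : K, χ - a • φ ∈ coboundaries δ X n) :
    Submodule.span K {cohomologyClass hφ} = ⊤ := by
  rw [← Set.pair_eq_singleton]
  refine span_pair_cohomologyClass_eq_top hφ hφ fun χ hχ => ?_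
  obtain ⟨a, ha⟩ := h χ hχ
  exact ⟨a, 0, by rwa [zero_smul, add_zero]⟩

theorem finrank_eq_one_of_span {v : M} (hv : v ≠ 0) (h : Submodule.span K {v} = ⊤) :
    Module.finrank K M = 1 := by
  rw [← finrank_top K M, ← h, finrank_span_singleton hv]

theorem finrank_eq_two_of_span {v w : M} (h : Submodule.span K {v, w} = ⊤)
    (hi : ∀ a b : K, a • v + b • w = 0 → a = 0 ∧ b = 0) : Module.finrank K M = 2 := by
  have hli : LinearIndependent K ![v, w] := LinearIndependent.pair_iff.mpr hi
  have := finrank_span_eq_card hli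
  rwa [Matrix.range_cons, Matrix.range_cons, Matrix.range_empty, Set.union_empty,
    Set.singleton_union, h, finrank_top, Fintype.card_fin] at this

end Classes

/-! ### The complexes `(E, D_e)` and `(C, D)` -/

section Complexes

variable {K : Type*} [Field K]

theorem comp_e_D (φ : C K) : comp .e (D K φ) = diff (comp .e φ) := (comp_D φ).1

theorem comp_f_D (φ : C K) : comp .f (D K φ) = anticomm (comp .e φ) - diff (comp .f φ) :=
  (comp_D φ).2

theorem comp_e_De (φ : C K) : comp .e (De K φ) = diff (comp .e φ) := by
  rw [← comp_e_D]
  funext I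
  simp [De, projE, comp_apply]

theorem comp_f_De (φ : C K) : comp .f (De K φ) = 0 := by
  funext I
  simp [De, projE, comp_apply]

theorem comp_zero (i : Letter) : comp i (0 : C K) = 0 := map_zero _

theorem isComplex_D : IsComplex (D K) (cochains K) := by
  intro n φ hφ
  obtain ⟨he, hf⟩ := mem_cochains_iff.mp hφ
  refine ⟨mem_cochains_iff.mpr ⟨?_, ?_⟩, ext_comp ?_ ?_⟩
  · rw [comp_e_D]; exact diff_mem he
  · rw [comp_f_D]; exact sub_mem (anticomm_mem he) (diff_mem hf)
  · simp [comp_e_D, diff_diff]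
  · simp [comp_e_D, comp_f_D, diff_diff, diff_anticomm]

theorem isComplex_De : IsComplex (De K) (E K) := by
  intro n φ hφ
  obtain ⟨he, -⟩ := mem_E_iff.mp hφ
  refine ⟨mem_E_iff.mpr ⟨?_, comp_f_De φ⟩, ext_comp ?_ ?_⟩
  · rw [comp_e_De]; exact diff_mem he
  · simp [comp_e_De, diff_diff]
  · simp [comp_f_De]

theorem comp_self_Ch (i : Letter) (n : ℕ) : comp i (Ch K i n) = chain n := by simp [comp_Ch]

theorem comp_f_Ch_e (n : ℕ) : comp .f (Ch K .e n) = 0 := by simp [comp_Ch]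

theorem comp_e_Ch_f (n : ℕ) : comp .e (Ch K .f n) = 0 := by simp [comp_Ch]

theorem mem_cocycles_De_iff {φ : C K} {n : ℕ} : φ ∈ cocycles (De K) (E K) n ↔
    (comp .e φ ∈ homogeneous K n ∧ comp .f φ = 0) ∧ diff (comp .e φ) = 0 := by
  rw [cocycles, Submodule.mem_inf, mem_E_iff, LinearMap.mem_ker]
  refine and_congr_right fun _ => ⟨fun h => ?_, fun h => ?_⟩
  · rw [← comp_e_De, h, comp_zero]
  · exact ext_comp (by rw [comp_e_De, h, comp_zero]) (by rw [comp_f_De, comp_zero])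

theorem mem_coboundaries_De_iff {φ : C K} {n : ℕ} (hφ : comp .f φ = 0) :
    φ ∈ coboundaries (De K) (E K) n ↔ comp .e φ ∈ boundaries K n := by
  cases n with
  | zero =>
    constructor
    · intro h
      obtain rfl : φ = 0 := h
      rw [comp_zero]; exact zero_mem _
    · intro h
      exact ext_comp (by rw [comp_zero]; exact h) (by rw [comp_zero, hφ])
  | succ n =>
    constructor
    · rintro ⟨ψ, hψ, rfl⟩
      rw [comp_e_De]
      exact diff_mem_boundaries (mem_E_iff.mp hψ).1
    · rintro ⟨x, hx, hd⟩
      refine ⟨ofComp x 0, mem_E_iff.mpr ⟨by rwa [comp_e_ofComp], comp_f_ofComp _ _⟩, ?_⟩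
      exact ext_comp (by rw [comp_e_De, comp_e_ofComp, hd]) (by rw [comp_f_De, hφ])

theorem Ch_e_mem_cocycles_De (n : ℕ) : Ch K .e n ∈ cocycles (De K) (E K) n := by
  rw [mem_cocycles_De_iff, comp_self_Ch, comp_f_Ch_e]
  exact ⟨⟨chain_mem n, rfl⟩, diff_chain n⟩

theorem span_class_Ch_e (n : ℕ) :
    Submodule.span K {cohomologyClass (Ch_e_mem_cocycles_De (K := K) n)} = ⊤ := by
  refine span_cohomologyClass_eq_top _ fun χ hχ => ?_
  obtain ⟨⟨hx, h0⟩, hd⟩ := mem_cocycles_De_iff.mp hχ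
  obtain ⟨c, b, hb, h⟩ := exists_eq_smul_chain_add n hx hd
  refine ⟨c, (mem_coboundaries_De_iff ?_).mpr ?_⟩
  · rw [map_sub, map_smul, h0, comp_f_Ch_e, smul_zero, sub_zero]
  · rwa [map_sub, map_smul, comp_self_Ch, h, add_sub_cancel_left]

theorem class_Ch_e_ne_zero (n : ℕ) :
    cohomologyClass (Ch_e_mem_cocycles_De (K := K) n) ≠ 0 := by
  rw [Ne, cohomologyClass_eq_zero_iff, mem_coboundaries_De_iff (comp_f_Ch_e n), comp_self_Ch]
  intro h
  exact one_ne_zero (eq_zero_of_smul_chain_mem_boundaries (by rwa [one_smul] : (1 : K) • _ ∈ _))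

theorem mem_cocycles_D_iff {φ : C K} {n : ℕ} : φ ∈ cocycles (D K) (cochains K) n ↔
    (comp .e φ ∈ homogeneous K n ∧ comp .f φ ∈ homogeneous K n) ∧
      diff (comp .e φ) = 0 ∧ anticomm (comp .e φ) = diff (comp .f φ) := by
  rw [cocycles, Submodule.mem_inf, mem_cochains_iff, LinearMap.mem_ker]
  refine and_congr_right fun _ => ⟨fun h => ⟨?_, ?_⟩, fun h => ext_comp ?_ ?_⟩
  · rw [← comp_e_D, h, comp_zero]
  · rw [← sub_eq_zero, ← comp_f_D, h, comp_zero]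
  · rw [comp_e_D, h.1, comp_zero]
  · rw [comp_f_D, h.2, sub_self, comp_zero]

theorem coboundaries_D_le_cocycles (n : ℕ) :
    coboundaries (D K) (cochains K) n ≤ cocycles (D K) (cochains K) n := by
  cases n with
  | zero => exact bot_le
  | succ n =>
    rintro _ ⟨ψ, hψ, rfl⟩
    exact isComplex_D n ψ hψ

theorem comp_e_mem_boundaries {φ : C K} {n : ℕ} (h : φ ∈ coboundaries (D K) (cochains K) n) :
    comp .e φ ∈ boundaries K n := by
  cases n with
  | zero =>
    obtain rfl : φ = 0 := h
    rw [comp_zero]; exact zero_mem _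
  | succ n =>
    obtain ⟨ψ, hψ, rfl⟩ := h
    rw [comp_e_D]
    exact diff_mem_boundaries (mem_cochains_iff.mp hψ).1

theorem exists_coboundary_comp_e {b : Word → K} {n : ℕ} (hb : b ∈ boundaries K n) :
    ∃ β ∈ coboundaries (D K) (cochains K) n, comp .e β = b := by
  cases n with
  | zero => exact ⟨0, zero_mem _, by rw [comp_zero]; exact (show b = 0 from hb).symm⟩
  | succ n =>
    obtain ⟨x, hx, rfl⟩ := hb
    refine ⟨D K (ofComp x 0), ⟨_, mem_cochains_iff.mpr ?_, rfl⟩, by rw [comp_e_D, comp_e_ofComp]⟩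
    rw [comp_e_ofComp, comp_f_ofComp]
    exact ⟨hx, zero_mem _⟩

theorem mem_coboundaries_D_of_comp_f {φ : C K} {n : ℕ} (he : comp .e φ = 0)
    (hf : comp .f φ ∈ boundaries K n) : φ ∈ coboundaries (D K) (cochains K) n := by
  cases n with
  | zero => exact ext_comp (by rw [he, comp_zero]) (by rw [comp_zero]; exact hf)
  | succ n =>
    obtain ⟨y, hy, hd⟩ := hf
    refine ⟨ofComp 0 (-y), mem_cochains_iff.mpr ?_, ext_comp ?_ ?_⟩
    · rw [comp_e_ofComp, comp_f_ofComp]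
      exact ⟨zero_mem _, neg_mem hy⟩
    · rw [comp_e_D, comp_e_ofComp, map_zero, he]
    · rw [comp_f_D, comp_e_ofComp, comp_f_ofComp, map_zero, map_neg, hd, sub_neg_eq_add, zero_add]

/-- If `n ≢ 1` modulo 4, the connecting map into `Hⁿ(F)` vanishes, so that a cochain with values
in `F` bounds in `C` only if it bounds in `F`. -/
theorem comp_f_mem_boundaries {φ : C K} {n : ℕ} (hn : n % 4 ≠ 1) (he : comp .e φ = 0)
    (h : φ ∈ coboundaries (D K) (cochains K) n) : comp .f φ ∈ boundaries K n := by
  cases n with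
  | zero =>
    obtain rfl : φ = 0 := h
    rw [comp_zero]; exact zero_mem _
  | succ n =>
    obtain ⟨ψ, hψ, rfl⟩ := h
    obtain ⟨hx, hy⟩ := mem_cochains_iff.mp hψ
    rw [comp_e_D] at he
    obtain ⟨c, b, hb, hc⟩ := exists_eq_smul_chain_add n hx he
    rw [comp_f_D, hc, map_add, map_smul]
    exact sub_mem (add_mem (Submodule.smul_mem _ c (anticomm_chain_mem (by omega)))
      (anticomm_mem_boundaries hb)) (diff_mem_boundaries hy)

theorem Ch_f_mem_cocycles (n : ℕ) : Ch K .f n ∈ cocycles (D K) (cochains K) n := by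
  rw [mem_cocycles_D_iff, comp_self_Ch, comp_e_Ch_f]
  exact ⟨⟨zero_mem _, chain_mem n⟩, map_zero _, by rw [map_zero, diff_chain]⟩

theorem Ch_f_mem_coboundaries (h2 : (2 : K) ≠ 0) {n : ℕ} (hn : n % 4 = 1) :
    Ch K .f n ∈ coboundaries (D K) (cochains K) n := by
  obtain ⟨m, rfl⟩ : ∃ m, n = m + 1 := ⟨n - 1, by omega⟩
  obtain ⟨w, hw, hd⟩ := anticomm_chain_sub_mem (K := K) (n := m) (by omega)
  -- with `x = Ch^m` and `d w = e x + x e - 2 x e`, the cochain `(x, w)` bounds `(0, 2 x e)`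
  have h : (2 : K) • Ch K .f (m + 1) = D K (ofComp (chain m) w) := by
    refine ext_comp ?_ ?_
    · rw [map_smul, comp_e_Ch_f, comp_e_D, comp_e_ofComp, diff_chain, smul_zero]
    · rw [map_smul, comp_self_Ch, comp_f_D, comp_e_ofComp, comp_f_ofComp, hd, sub_sub_cancel]
  have hmem : (2 : K) • Ch K .f (m + 1) ∈ coboundaries (D K) (cochains K) (m + 1) := by
    rw [h]
    exact ⟨_, mem_cochains_iff.mpr ⟨by rw [comp_e_ofComp]; exact chain_mem m,
      by rwa [comp_f_ofComp]⟩, rfl⟩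
  exact (Submodule.smul_mem_iff _ h2).mp hmem

theorem smul_Ch_f_mem_coboundaries {n : ℕ} (hn : n % 4 ≠ 1) {c : K}
    (h : c • Ch K .f n ∈ coboundaries (D K) (cochains K) n) : c = 0 := by
  have h' := comp_f_mem_boundaries hn (by rw [map_smul, comp_e_Ch_f, smul_zero]) h
  rw [map_smul, comp_self_Ch] at h'
  exact eq_zero_of_smul_chain_mem_boundaries h'

theorem class_Ch_f_ne_zero_iff (h2 : (2 : K) ≠ 0) (n : ℕ) :
    cohomologyClass (Ch_f_mem_cocycles (K := K) n) ≠ 0 ↔ n % 4 ≠ 1 := by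
  rw [Ne, cohomologyClass_eq_zero_iff]
  refine not_congr ⟨fun h => ?_, Ch_f_mem_coboundaries h2⟩
  by_contra hn
  exact one_ne_zero (smul_Ch_f_mem_coboundaries hn (by rwa [one_smul] : (1 : K) • _ ∈ _))

theorem eq_zero_of_anticomm_mem (h2 : (2 : K) ≠ 0) {n : ℕ} (hn : n % 4 = 0) {c : K}
    (h : c • anticomm (chain n) ∈ boundaries K (n + 1)) : c = 0 := by
  have h' := sub_mem h (Submodule.smul_mem _ c (anticomm_chain_sub_mem hn))
  rw [← smul_sub, sub_sub_cancel, smul_smul] at h'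
  exact (mul_eq_zero.mp (eq_zero_of_smul_chain_mem_boundaries h')).resolve_right h2

/-- A `D`-cocycle with values in `F` is cohomologous to a multiple of `Ch^n_f`. -/
theorem exists_sub_smul_Ch_f_mem {φ : C K} {n : ℕ} (hφ : φ ∈ cocycles (D K) (cochains K) n)
    (he : comp .e φ = 0) : ∃ c : K, φ - c • Ch K .f n ∈ coboundaries (D K) (cochains K) n := by
  obtain ⟨⟨-, hy⟩, -, hd⟩ := mem_cocycles_D_iff.mp hφ
  rw [he, map_zero] at hd
  obtain ⟨c, b, hb, h⟩ := exists_eq_smul_chain_add n hy hd.symm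
  refine ⟨c, mem_coboundaries_D_of_comp_f ?_ ?_⟩
  · rw [map_sub, map_smul, he, comp_e_Ch_f, smul_zero, sub_zero]
  · rwa [map_sub, map_smul, comp_self_Ch, h, add_sub_cancel_left]

/-- Modulo a coboundary, the `E`-component of a `D`-cocycle is a multiple of `θ^m` or `θ^m e`;
this multiple is killed by the connecting map. -/
theorem exists_comp_e_eq {φ : C K} {n : ℕ} (hφ : φ ∈ cocycles (D K) (cochains K) n) :
    ∃ c : K, ∃ β ∈ coboundaries (D K) (cochains K) n, comp .e (φ - β) = c • chain n ∧
      c • anticomm (chain n) ∈ boundaries K (n + 1) := by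
  obtain ⟨⟨hx, hy⟩, hdx, hdy⟩ := mem_cocycles_D_iff.mp hφ
  obtain ⟨c, b, hb, h⟩ := exists_eq_smul_chain_add n hx hdx
  obtain ⟨β, hβ, rfl⟩ := exists_coboundary_comp_e hb
  refine ⟨c, β, hβ, by rw [map_sub, h, add_sub_cancel_right], ?_⟩
  have : c • anticomm (chain n) = diff (comp .f φ) - anticomm (comp .e β) := by
    rw [← hdy, h, map_add, map_smul, add_sub_cancel_right]
  rw [this]
  exact sub_mem (diff_mem_boundaries hy) (anticomm_mem_boundaries hb)

theorem comp_e_of_isExtension {n : ℕ} {η : C K} (hη : IsExtension K n η) :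
    comp .e (Ch K .e n + η) = chain n := by
  rw [map_add, comp_self_Ch, (mem_F_iff.mp hη.1).1, add_zero]

theorem exists_isExtension_iff (h2 : (2 : K) ≠ 0) (n : ℕ) :
    (∃ η, IsExtension K n η) ↔ n % 4 ≠ 0 := by
  constructor
  · rintro ⟨η, hη⟩ hn
    obtain ⟨⟨-, hy⟩, -, hd⟩ := mem_cocycles_D_iff.mp hη.2
    rw [comp_e_of_isExtension hη] at hd
    refine one_ne_zero (eq_zero_of_anticomm_mem h2 hn (c := (1 : K)) ?_)
    rw [one_smul, hd]
    exact diff_mem_boundaries hy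
  · intro hn
    obtain ⟨y, hy, hd⟩ := anticomm_chain_mem (K := K) hn
    refine ⟨ofComp 0 y, mem_F_iff.mpr ⟨comp_e_ofComp _ _, by rwa [comp_f_ofComp]⟩,
      mem_cocycles_D_iff.mpr ?_⟩
    rw [map_add, map_add, comp_self_Ch, comp_f_Ch_e, comp_e_ofComp, comp_f_ofComp, add_zero,
      zero_add]
    exact ⟨⟨chain_mem n, hy⟩, diff_chain n, hd.symm⟩

theorem span_class_Ch_f (h2 : (2 : K) ≠ 0) {n : ℕ} (hn : n % 4 = 0) :
    Submodule.span K {cohomologyClass (Ch_f_mem_cocycles (K := K) n)} = ⊤ := by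
  refine span_cohomologyClass_eq_top _ fun χ hχ => ?_
  obtain ⟨c, β, hβ, he, hc⟩ := exists_comp_e_eq hχ
  rw [eq_zero_of_anticomm_mem h2 hn hc, zero_smul] at he
  obtain ⟨a, ha⟩ := exists_sub_smul_Ch_f_mem (sub_mem hχ (coboundaries_D_le_cocycles n hβ)) he
  refine ⟨a, ?_⟩
  have := add_mem ha hβ
  rwa [sub_right_comm, sub_add_cancel] at this

theorem span_class_extension {n : ℕ} {η : C K} (hη : IsExtension K n η) :
    Submodule.span K
      {cohomologyClass hη.2, cohomologyClass (Ch_f_mem_cocycles (K := K) n)} = ⊤ := by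
  refine span_pair_cohomologyClass_eq_top _ _ fun χ hχ => ?_
  obtain ⟨c, β, hβ, he, -⟩ := exists_comp_e_eq hχ
  obtain ⟨a, ha⟩ := exists_sub_smul_Ch_f_mem
    (sub_mem (sub_mem hχ (coboundaries_D_le_cocycles n hβ)) (Submodule.smul_mem _ c hη.2))
    (by rw [map_sub, he, map_smul, comp_e_of_isExtension hη, sub_self])
  refine ⟨c, a, ?_⟩
  have := add_mem ha hβ
  convert this using 1
  abel

theorem eq_zero_of_smul_extension_add {n : ℕ} {η : C K} (hη : IsExtension K n η) {a b : K}
    (h : a • (Ch K .e n + η) + b • Ch K .f n ∈ coboundaries (D K) (cochains K) n) : a = 0 := by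
  have h' := comp_e_mem_boundaries h
  rw [map_add, map_smul, map_smul, comp_e_of_isExtension hη, comp_e_Ch_f, smul_zero, add_zero]
    at h'
  exact eq_zero_of_smul_chain_mem_boundaries h'

theorem finrank_cohomology_eq_one (h2 : (2 : K) ≠ 0) {n : ℕ} (hn : n % 4 = 0 ∨ n % 4 = 1) :
    Module.finrank K (cohomology (D K) (cochains K) n) = 1 := by
  rcases hn with hn | hn
  · exact finrank_eq_one_of_span ((class_Ch_f_ne_zero_iff h2 n).mpr (by omega))
      (span_class_Ch_f h2 hn)
  · obtain ⟨η, hη⟩ := (exists_isExtension_iff h2 n).mpr (by omega)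
    have hs := span_class_extension hη
    rw [(cohomologyClass_eq_zero_iff _).mpr (Ch_f_mem_coboundaries h2 hn), Set.pair_comm,
      Submodule.span_insert_zero] at hs
    refine finrank_eq_one_of_span (fun h => ?_) hs
    refine one_ne_zero (eq_zero_of_smul_extension_add hη (a := (1 : K)) (b := 0) ?_)
    rw [one_smul, zero_smul, add_zero]
    exact (cohomologyClass_eq_zero_iff _).mp h

theorem finrank_cohomology_eq_two (h2 : (2 : K) ≠ 0) {n : ℕ} (hn : n % 4 = 2 ∨ n % 4 = 3) :
    Module.finrank K (cohomology (D K) (cochains K) n) = 2 := by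
  obtain ⟨η, hη⟩ := (exists_isExtension_iff h2 n).mpr (by omega)
  refine finrank_eq_two_of_span (span_class_extension hη) fun a b h => ?_
  rw [smul_add_smul_cohomologyClass, cohomologyClass_eq_zero_iff] at h
  obtain rfl := eq_zero_of_smul_extension_add hη h
  rw [zero_smul, zero_add] at h
  exact ⟨rfl, smul_Ch_f_mem_coboundaries (by omega) h⟩

end Complexes

end OneOne

theorem mainTheorem3 (K : Type*) [Field K] (h2 : (2 : K) ≠ 0) (h3 : (3 : K) ≠ 0) :
    -- `(C, D)` and `(E, D_e)` are complexes
    OneOne.IsComplex (OneOne.D K) (OneOne.cochains K) ∧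
    OneOne.IsComplex (OneOne.De K) (OneOne.E K) ∧
    -- the dimension of `Hⁿ(d₆)`
    (∀ n : ℕ, n % 4 = 0 ∨ n % 4 = 1 →
      Module.finrank K (OneOne.cohomology (OneOne.D K) (OneOne.cochains K) n) = 1) ∧
    (∀ n : ℕ, n % 4 = 2 ∨ n % 4 = 3 →
      Module.finrank K (OneOne.cohomology (OneOne.D K) (OneOne.cochains K) n) = 2) ∧
    -- the cohomology of `(E, D_e)` is one-dimensional, spanned by the class of `Ch^n_e`
    (∀ n : ℕ,
      Module.finrank K (OneOne.cohomology (OneOne.De K) (OneOne.E K) n) = 1 ∧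
      ∃ h : OneOne.Ch K .e n ∈ OneOne.cocycles (OneOne.De K) (OneOne.E K) n,
        Submodule.span K {OneOne.cohomologyClass h} = ⊤) ∧
    -- when `Ch^n_e` extends to a `D`-cocycle
    (∀ n : ℕ, (∃ η, OneOne.IsExtension K n η) ↔ n % 4 ≠ 0) ∧
    -- `Ch^n_f` is a `D`-cocycle; when it is nontrivial; generators of `Hⁿ(d₆)`
    (∀ n : ℕ,
      ∃ hf : OneOne.Ch K .f n ∈ OneOne.cocycles (OneOne.D K) (OneOne.cochains K) n,
        (OneOne.cohomologyClass hf ≠ 0 ↔ n % 4 ≠ 1) ∧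
        (n % 4 = 0 → Submodule.span K {OneOne.cohomologyClass hf} = ⊤) ∧
        ∀ (η : OneOne.C K) (hη : OneOne.IsExtension K n η),
          Submodule.span K
            {OneOne.cohomologyClass hη.2, OneOne.cohomologyClass hf} = ⊤) := by

  exact ⟨OneOne.isComplex_D, OneOne.isComplex_De,
    fun _ => OneOne.finrank_cohomology_eq_one h2, fun _ => OneOne.finrank_cohomology_eq_two h2,
    fun n => ⟨OneOne.finrank_eq_one_of_span (OneOne.class_Ch_e_ne_zero n)
      (OneOne.span_class_Ch_e n), OneOne.Ch_e_mem_cocycles_De n, OneOne.span_class_Ch_e n⟩,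
    OneOne.exists_isExtension_iff h2,
    fun n => ⟨OneOne.Ch_f_mem_cocycles n, OneOne.class_Ch_f_ne_zero_iff h2 n,
      OneOne.span_class_Ch_f h2, fun _ => OneOne.span_class_extension⟩⟩
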